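/- For an integer $n\ge 1$ let $\beta_n$ be the braid on six strands $$\beta_n=(\sigma_3\sigma_2\sigma_4\sigma_1\sigma_3\sigma_5\sigma_2\sigma_4\sigma_3)^{2n+1}\,\sigma_3\sigma_2\sigma_1\sigma_1\sigma_2\sigma_3\sigma_2\sigma_1\sigma_2\sigma_2,$$ where $\sigma_1,\dots,\sigma_5$ are the standard generators of the braid group on six strands, and let $K_n$ be the knot obtained as the closure of $\beta_n$. Write $\doteq$ for equality in $\mathbb{Z}[t,t^{-1}]$ up to multiplication by a unit $\pm t^k$; the Alexander polynomial of a knot is well defined up to $\doteq$. Then the Alexander polynomial of $K_n$ is $$\Delta_{K_n}(t)\doteq t^{6n+4}+\sum_{i=0}^{n}(A_1+A_2+A_3+A_4+A_5),$$ where $$A_1=t^{6(n-i)}-t^{6(n-i)+1},\qquad A_2=t^{6(n+i)+6}-t^{6(n+i)+5},\qquad A_3=t^{6(n+i)+8}-t^{6(n+i)+7},$$ $$A_4=t^{6(n+i)+10}-t^{6(n+i)+9},\qquad A_5=t^{6(2n+i)+14}-t^{6(2n+i)+13}.$$ Equivalently, $$\Delta_{K_n}(t)\doteq\frac{t^{18n+19}+t^{12n+15}+t^{12n+11}+t^{6n+8}+t^{6n+4}+1}{1+t+t^2+t^3+t^4+t^5}.$$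 -/

import Mathlib

open LaurentPolynomial

noncomputable section

/-! ### Free differential calculus -/

/-- The affine action of the free group on its integral group ring in which the generator `y` acts
by `v ↦ ∂y/∂x + y v`. A word `w` then acts by `v ↦ ∂w/∂x + w v`. -/
def foxAction {α : Type*} [DecidableEq α] (x : α) :
    FreeGroup α →* Equiv.Perm (MonoidAlgebra ℤ (FreeGroup α)) :=
  FreeGroup.lift fun y =>
    { toFun := fun v => (if y = x then 1 else 0) + MonoidAlgebra.of ℤ _ (FreeGroup.of y) * v
      invFun := fun v =>
        MonoidAlgebra.of ℤ _ ((FreeGroup.of y)⁻¹) * (v - (if y = x then 1 else 0))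
      left_inv := fun v => by
        beta_reduce
        rw [add_sub_cancel_left, ← mul_assoc, ← map_mul, inv_mul_cancel, map_one, one_mul]
      right_inv := fun v => by
        beta_reduce
        rw [← mul_assoc, ← map_mul, mul_inv_cancel, map_one, one_mul, add_sub_cancel] }

/-- The Fox derivative `∂w/∂x ∈ ℤ[F]` of a word `w` in the free group `F`. The lemmas below are
its defining properties. -/
def foxDeriv {α : Type*} [DecidableEq α] (x : α) (w : FreeGroup α) :
    MonoidAlgebra ℤ (FreeGroup α) :=
  foxAction x w 0

theorem foxAction_apply {α : Type*} [DecidableEq α] (x : α) (w : FreeGroup α)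
    (v : MonoidAlgebra ℤ (FreeGroup α)) :
    foxAction x w v = foxDeriv x w + MonoidAlgebra.of ℤ _ w * v := by
  have key : ∀ w : FreeGroup α, ∀ u v : MonoidAlgebra ℤ (FreeGroup α),
      foxAction x w (u + v) = foxAction x w u + MonoidAlgebra.of ℤ _ w * v := by
    intro w
    induction w using FreeGroup.induction_on with
    | C1 => intro u v; simp only [map_one, Equiv.Perm.coe_one, id_eq, one_mul]
    | of y =>
      intro u v
      simp only [foxAction, FreeGroup.lift_apply_of, Equiv.coe_fn_mk, mul_add, add_assoc]
    | inv_of y _ =>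
      intro u v
      rw [map_inv]
      simp only [foxAction, FreeGroup.lift_apply_of, Equiv.Perm.inv_def, Equiv.coe_fn_symm_mk]
      rw [← mul_add, add_sub_right_comm]
    | mul a b ha hb =>
      intro u v
      simp only [map_mul, Equiv.Perm.mul_apply, hb, ha, mul_assoc]
  have h := key w 0 v
  rwa [zero_add] at h

theorem foxDeriv_of {α : Type*} [DecidableEq α] (x y : α) :
    foxDeriv x (FreeGroup.of y) = if y = x then 1 else 0 := by
  simp [foxDeriv, foxAction]

theorem foxDeriv_mul {α : Type*} [DecidableEq α] (x : α) (u w : FreeGroup α) :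
    foxDeriv x (u * w) = foxDeriv x u + MonoidAlgebra.of ℤ _ u * foxDeriv x w := by
  rw [← foxAction_apply]
  simp [foxDeriv]

/-- The ring homomorphism `ℤ[F] → ℤ[t, t⁻¹]` that sends every generator of `F` to `t`. -/
def sendToT (α : Type*) : MonoidAlgebra ℤ (FreeGroup α) →ₐ[ℤ] ℤ[T;T⁻¹] :=
  MonoidAlgebra.lift ℤ ℤ[T;T⁻¹] (FreeGroup α)
    ((AddMonoidAlgebra.of ℤ ℤ).comp (FreeGroup.lift fun _ : α => Multiplicative.ofAdd (1 : ℤ)))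

/-- The Alexander matrix of a presentation `⟨α | r i, i ∈ ι⟩` all of whose generators are
meridians: the Fox Jacobian of the relators, mapped to `ℤ[t, t⁻¹]`. -/
def alexanderMatrix {α ι : Type*} [DecidableEq α] (r : ι → FreeGroup α) :
    Matrix ι α ℤ[T;T⁻¹] :=
  Matrix.of fun i a => sendToT α (foxDeriv a (r i))

/-- The `d`-th elementary ideal of a matrix with `c` columns: the ideal generated by its minors of
order `c - d`. (A choice of rows or columns with repetitions contributes the minor `0`; for `c ≤ d`
the empty minor `1` gives the unit ideal.) -/
def elementaryIdeal {ι α R : Type*} [Fintype α] [CommRing R] (d : ℕ) (M : Matrix ι α R) :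
    Ideal R :=
  Ideal.span {x | ∃ (f : Fin (Fintype.card α - d) → ι) (g : Fin (Fintype.card α - d) → α),
    x = (M.submatrix f g).det}

/-! ### Closed braids -/

/-- A word in the standard generators of the braid group on `m + 1` strands. The letter `(j, true)`
is `σ_{j+1}`, the crossing of the strands in positions `j` and `j + 1` (counted from `0`), and
`(j, false)` is its inverse. -/
abbrev BraidWord (m : ℕ) := List (Fin m × Bool)

/-- The edges of the diagram of the closure of a braid word, cut along the horizontal levels
`0, …, w.length` that separate the crossings: `(k, i)` is the edge in position `i` at level `k`.
All edges are oriented in the direction of increasing level. -/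
abbrev BraidWord.Edge {m : ℕ} (w : BraidWord m) := Fin (w.length + 1) × Fin (m + 1)

/-- The Wirtinger rule at one crossing: given the meridians `x i` of the edges right above a letter,
the meridians of the edges right below it. At `σ_{j+1}` the strand that starts in position `j`
passes over to position `j + 1`; at its inverse the strand that starts in position `j + 1` passes
over to position `j`. The meridian of the strand that passes under is conjugated by the meridian
of the strand that passes over. -/
def wirtingerStep {G : Type*} [Group G] {m : ℕ} (s : Fin m × Bool) (x : Fin (m + 1) → G) :
    Fin (m + 1) → G :=
  fun i =>
    let a := x s.1.castSucc
    let b := x s.1.succ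
    if i = s.1.castSucc then (if s.2 then a * b * a⁻¹ else b)
    else if i = s.1.succ then (if s.2 then a else b⁻¹ * a * b)
    else x i

/-- The relators of the Wirtinger presentation of the group of the closure of a braid word. The
generators are the meridians of the edges; there is one relator for each edge that leaves the
`k`-th letter, and one for each strand of the closure, which joins the last level to the first. -/
def BraidWord.relator {m : ℕ} (w : BraidWord m) :
    (Fin w.length × Fin (m + 1)) ⊕ Fin (m + 1) → FreeGroup w.Edge
  | Sum.inl (k, i) =>
      FreeGroup.of (k.succ, i) *
        (wirtingerStep (w.get k) (fun j => FreeGroup.of (k.castSucc, j)) i)⁻¹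
  | Sum.inr i => FreeGroup.of (Fin.last w.length, i) * (FreeGroup.of (0, i))⁻¹

/-- `Δ` is an Alexander polynomial of the closure of the braid word `w`: it generates the smallest
principal ideal of `ℤ[t, t⁻¹]` that contains the first elementary ideal of the Alexander matrix. -/
def BraidWord.IsAlexanderPolynomial {m : ℕ} (w : BraidWord m) (Δ : ℤ[T;T⁻¹]) : Prop :=
  IsLeast {I : Ideal ℤ[T;T⁻¹] | (∃ p, I = Ideal.span {p}) ∧
      elementaryIdeal 1 (alexanderMatrix w.relator) ≤ I}
    (Ideal.span {Δ})

/-- The letter `σ_i`, for `i = 1, …, 5`, of the braid group on six strands. -/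
def sigma (i : ℕ) (h : 1 ≤ i ∧ i ≤ 5 := by decide) : Fin 5 × Bool :=
  (⟨i - 1, by omega⟩, true)

/-- The braid
`(σ₃σ₂σ₄σ₁σ₃σ₅σ₂σ₄σ₃)^(2n+1) σ₃σ₂σ₁σ₁σ₂σ₃σ₂σ₁σ₂σ₂` on six strands. Its closure is the knot `K_n`. -/
def betaWord (n : ℕ) : BraidWord 5 :=
  (List.replicate (2 * n + 1)
    [sigma 3, sigma 2, sigma 4, sigma 1, sigma 3, sigma 5, sigma 2, sigma 4, sigma 3]).flatten ++
  [sigma 3, sigma 2, sigma 1, sigma 1, sigma 2, sigma 3, sigma 2, sigma 1, sigma 2, sigma 2]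

end

/-!
For any word `w` in the braid generators, the first elementary ideal of the Alexander matrix of the
closure is principal, generated by a minor of corank one of `B_w - 1`, where `B_w` is the unreduced
Burau matrix of `w` (`BraidWord.isAlexanderPolynomial_iff_associated`). Two facts are behind this.

* Every letter changes the meridians by a Burau matrix that fixes the column `(1, …, 1)` and the row
  `(1, t, t², …)`. Hence the Alexander matrix, which is square, has rows of sum zero and a left null
  vector with unit entries, and its minors of corank one agree up to units
  (`elementaryIdeal_one_eq_span`).
* The relators express the meridians at each level by those at level `0`, so the meridians of all
  other levels can be eliminated without changing the determinant
  (`BraidWord.det_alexanderMatrix_updateRow`).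

The block `σ₃σ₂σ₄σ₁σ₃σ₅σ₂σ₄σ₃` passes three parallel strands over three others. Its Burau matrix is
`A = [[(1 - t) J, t³], [1, 0]]` with `J = (1, 1, 1)ᵀ (1, t, t²)` of rank one. On the vectors whose
two halves are killed by `(1, t, t²)` the square `A²` is multiplication by `t³`; on the span of the
two copies of `(1, 1, 1)ᵀ` the eigenvalues of `A` are `1` and `-t³`. After a scaling by
`q = 1 + t + ⋯ + t⁵`, the matrix `A ^ (2 * n + 1)` in a basis adapted to these subspaces is therefore
polynomial in `t` and `u = t ^ (3 * n)` (`blockMatrix_pow_mul_basisMatrix`), and the minor becomes a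
single determinant over `ℤ[t, u]` (`det_updateRow_tailMatrix_mul_powerMatrix_sub_basisMatrix`). It
yields `-q` times the minor as the six-term numerator of the closed formula; the sum formula times
`q` telescopes to the same numerator.
-/

noncomputable section

/-! ### Cofactors of a matrix with a left and a right null vector -/

theorem det_eq_zero_of_vecMul_eq_zero_of_isUnit {ι R : Type*} [Fintype ι] [DecidableEq ι]
    [CommRing R] {A : Matrix ι ι R} {v : ι → R} (h : Matrix.vecMul v A = 0) {i : ι}
    (hv : IsUnit (v i)) : A.det = 0 := by
  have h1 : Matrix.vecMul (Matrix.vecMul v A) A.adjugate = 0 := by rw [h, Matrix.zero_vecMul]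
  rw [Matrix.vecMul_vecMul, Matrix.mul_adjugate, Matrix.vecMul_smul, Matrix.vecMul_one] at h1
  have h2 := congrFun h1 i
  simp only [Pi.smul_apply, smul_eq_mul, Pi.zero_apply] at h2
  exact (hv.mul_left_eq_zero).1 h2

theorem det_eq_zero_of_mulVec_eq_zero_of_isUnit {ι R : Type*} [Fintype ι] [DecidableEq ι]
    [CommRing R] {A : Matrix ι ι R} {v : ι → R} (h : Matrix.mulVec A v = 0) {i : ι}
    (hv : IsUnit (v i)) : A.det = 0 := by
  rw [← Matrix.det_transpose]
  exact det_eq_zero_of_vecMul_eq_zero_of_isUnit (v := v) (by rwa [Matrix.vecMul_transpose]) hv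

/-- If the rows of `N` sum to zero, then the cofactors along each row of `N` are equal. -/
theorem adjugate_apply_eq_of_mulVec_one {ι R : Type*} [Fintype ι] [DecidableEq ι] [CommRing R]
    {N : Matrix ι ι R} (h : N.mulVec 1 = 0) (i i' j : ι) :
    N.adjugate i j = N.adjugate i' j := by
  -- The difference is the determinant of a matrix whose rows still sum to zero.
  rw [← sub_eq_zero, Matrix.adjugate_apply, Matrix.adjugate_apply, sub_eq_add_neg, ← neg_one_mul,
    ← Matrix.det_updateRow_smul, ← Matrix.det_updateRow_add]
  refine det_eq_zero_of_mulVec_eq_zero_of_isUnit (v := 1) (i := i) ?_ isUnit_one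
  ext k
  rcases eq_or_ne k j with rfl | hk
  · simp [Matrix.mulVec, dotProduct, Finset.sum_add_distrib]
  · simpa [Matrix.mulVec, dotProduct, Matrix.updateRow_ne hk] using congrFun h k

/-- A left null vector of `N` with unit entries gives the ratios of the cofactors along each
column of `N`. -/
theorem adjugate_apply_mul_eq_of_vecMul {ι R : Type*} [Fintype ι] [DecidableEq ι] [CommRing R]
    {N : Matrix ι ι R} {v : ι → R} (h : Matrix.vecMul v N = 0) (hv : ∀ i, IsUnit (v i))
    (i j j' : ι) : v j' * N.adjugate i j = v j * N.adjugate i j' := by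
  rw [← sub_eq_zero, ← Matrix.transpose_apply N.adjugate, ← Matrix.transpose_apply N.adjugate,
    Matrix.adjugate_transpose, Matrix.adjugate_apply, Matrix.adjugate_apply, sub_eq_add_neg,
    ← neg_mul, ← Matrix.det_updateRow_smul, ← Matrix.det_updateRow_smul,
    ← Matrix.det_updateRow_add]
  refine det_eq_zero_of_mulVec_eq_zero_of_isUnit (v := v) (i := i) ?_ (hv i)
  ext k
  rcases eq_or_ne k i with rfl | hk
  · simp [Matrix.mulVec, dotProduct, Pi.single_apply, mul_comm,
      mul_add, Finset.sum_add_distrib]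
  · have := congrFun h k
    simpa [Matrix.mulVec, Matrix.vecMul, dotProduct, Matrix.updateRow_ne hk, mul_comm] using this

theorem associated_adjugate_apply {ι R : Type*} [Fintype ι] [DecidableEq ι] [CommRing R]
    {N : Matrix ι ι R} (h1 : N.mulVec 1 = 0) {v : ι → R} (h : Matrix.vecMul v N = 0)
    (hv : ∀ i, IsUnit (v i)) (i j i' j' : ι) :
    Associated (N.adjugate i j) (N.adjugate i' j') := by
  rw [adjugate_apply_eq_of_mulVec_one h1 i i' j]
  have := adjugate_apply_mul_eq_of_vecMul h hv i' j j'
  rw [← associated_isUnit_mul_left_iff (hv j'), ← associated_isUnit_mul_right_iff (hv j), this]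
  exact Associated.refl _

theorem exists_equiv_fin_succ_extending {k : ℕ} {ι : Type*} [Fintype ι]
    (hk : Fintype.card ι = k + 1) {f : Fin k → ι} (hf : Function.Injective f) :
    ∃ e : Fin (k + 1) ≃ ι, ∀ i, e i.succ = f i := by
  obtain ⟨a, ha⟩ : ∃ a, a ∉ Set.range f := by
    by_contra! hc
    have := Fintype.card_le_of_surjective f hc
    simp only [Fintype.card_fin] at this
    omega
  refine ⟨Equiv.ofBijective (Fin.cons a f : Fin (k + 1) → ι) ?_, fun i => rfl⟩
  exact (Fintype.bijective_iff_injective_and_card _).2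
    ⟨Fin.cons_injective_iff.2 ⟨ha, hf⟩, by rw [Fintype.card_fin, hk]⟩

/-- A minor of corank one is, up to sign, a cofactor. -/
theorem associated_det_submatrix_adjugate {k : ℕ} {ι R : Type*} [Fintype ι] [DecidableEq ι]
    [CommRing R] (N : Matrix ι ι R) (e e' : Fin (k + 1) ≃ ι) :
    Associated (N.submatrix (fun i : Fin k => e i.succ) (fun i : Fin k => e' i.succ)).det
      (N.adjugate (e' 0) (e 0)) := by
  have h1 : (N.submatrix (fun i : Fin k => e i.succ) (fun i : Fin k => e' i.succ)).det =
      (N.submatrix e e').adjugate 0 0 := by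
    rw [Matrix.adjugate_fin_succ_eq_det_submatrix]
    simp [Matrix.submatrix_submatrix, Function.comp_def]
  have h2 : (N.submatrix e e').updateRow 0 (Pi.single 0 1) =
      ((N.updateRow (e 0) (Pi.single (e' 0) 1)).submatrix e' e').submatrix (e.trans e'.symm) id := by
    ext i j
    rcases eq_or_ne i 0 with rfl | hi
    · simp [Pi.single_apply]
    · simp [Matrix.updateRow_ne hi, Matrix.updateRow_ne (e.injective.ne hi)]
  rw [h1, Matrix.adjugate_apply, h2, Matrix.det_permute, Matrix.det_submatrix_equiv_self,
    Matrix.adjugate_apply]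
  exact associated_unit_mul_left _ _ ((Units.isUnit _).map (Int.castRingHom R))

/-- A matrix `M`, square up to the bijection `e` between rows and columns, whose rows sum to zero
and that has a left null vector with unit entries, has a principal first elementary ideal, generated
by any of the minors of corank one. Here the minor is written as the determinant in which row `r`
is replaced by the basis vector at column `s`. -/
theorem elementaryIdeal_one_eq_span {ι α R : Type*} [Fintype ι] [DecidableEq ι] [Fintype α]
    [CommRing R] (M : Matrix ι α R) (e : ι ≃ α) (h1 : M.mulVec 1 = 0) {v : ι → R}
    (h : Matrix.vecMul v M = 0) (hv : ∀ i, IsUnit (v i)) (r s : ι) :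
    elementaryIdeal 1 M =
      Ideal.span {((M.submatrix id e).updateRow r (Pi.single s 1)).det} := by
  classical
  set N : Matrix ι ι R := M.submatrix id e with hN
  have hN1 : N.mulVec 1 = 0 := by
    ext i
    have := congrFun h1 i
    simp only [Matrix.mulVec, dotProduct, Pi.one_apply, mul_one, hN, Matrix.submatrix_apply,
      id_eq] at this ⊢
    rwa [Equiv.sum_comp e (fun a => M i a)]
  have hNv : Matrix.vecMul v N = 0 := by
    ext i
    exact congrFun h (e i)
  rw [← Matrix.adjugate_apply]
  obtain ⟨k, hk⟩ : ∃ k, Fintype.card ι = k + 1 :=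
    Nat.exists_eq_succ_of_ne_zero (Fintype.card_pos_iff.2 ⟨r⟩).ne'
  have hkα : Fintype.card α = k + 1 := by rw [← Fintype.card_congr e, hk]
  have hmin : ∀ k', k' = k → (f : Fin k' → ι) → (g : Fin k' → α) → Function.Injective f →
      Function.Injective g → Associated (M.submatrix f g).det (N.adjugate s r) := by
    rintro _ rfl f g hf hg
    obtain ⟨a, ha⟩ := exists_equiv_fin_succ_extending hk hf
    obtain ⟨b, hb⟩ := exists_equiv_fin_succ_extending hk (e.symm.injective.comp hg)
    have hfg : M.submatrix f g = N.submatrix (fun i => a i.succ) (fun i => b i.succ) := by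
      ext i j
      simp [hN, ha, hb]
    rw [hfg]
    exact (associated_det_submatrix_adjugate N a b).trans
      (associated_adjugate_apply hN1 hNv hv _ _ _ _)
  have hkα' : Fintype.card α - 1 = k := by omega
  apply le_antisymm
  · rw [elementaryIdeal, Ideal.span_le]
    rintro _ ⟨f, g, rfl⟩
    rw [SetLike.mem_coe, Ideal.mem_span_singleton]
    by_cases hf : Function.Injective f
    · by_cases hg : Function.Injective g
      · exact (hmin _ hkα' f g hf hg).symm.dvd
      · obtain ⟨i, j, hij, hne⟩ := Function.not_injective_iff.1 hg
        rw [Matrix.det_zero_of_column_eq hne (by simp [hij])]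
        exact dvd_zero _
    · obtain ⟨i, j, hij, hne⟩ := Function.not_injective_iff.1 hf
      rw [Matrix.det_zero_of_row_eq hne (by ext; simp [hij])]
      exact dvd_zero _
  · let c : Fin (Fintype.card α - 1) → ι := fun i =>
      (Fintype.equivFinOfCardEq hk).symm (Fin.cast hkα' i).succ
    have hc : Function.Injective c := fun i j hij => by
      simpa [c] using hij
    rw [Ideal.span_singleton_le_iff_mem]
    have := hmin _ hkα' c (e ∘ c) hc (e.injective.comp hc)
    exact Ideal.mem_of_dvd _ this.dvd (Ideal.subset_span ⟨c, e ∘ c, rfl⟩)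

/-! ### Fox gradients and the Wirtinger rule -/

theorem sendToT_of_of {α : Type*} (a : α) :
    sendToT α (MonoidAlgebra.of ℤ _ (FreeGroup.of a)) = T 1 := by
  rw [sendToT, MonoidAlgebra.lift_of, MonoidHom.comp_apply, FreeGroup.lift_apply_of]
  rfl

theorem sendToT_of_inv_of {α : Type*} (a : α) :
    sendToT α (MonoidAlgebra.of ℤ _ (FreeGroup.of a)⁻¹) = T (-1) := by
  rw [sendToT, MonoidAlgebra.lift_of, MonoidHom.comp_apply, map_inv, FreeGroup.lift_apply_of]
  rfl

/-- The vector of all Fox derivatives of a word, mapped to `ℤ[t, t⁻¹]`: the row that the word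
contributes to an Alexander matrix. -/
def foxGradient {α : Type*} [DecidableEq α] (w : FreeGroup α) : α → ℤ[T;T⁻¹] :=
  fun a => sendToT α (foxDeriv a w)

theorem foxGradient_of {α : Type*} [DecidableEq α] (a : α) :
    foxGradient (FreeGroup.of a) = Pi.single a 1 := by
  ext1 b
  rw [foxGradient, foxDeriv_of, Pi.single_apply]
  simp only [eq_comm (a := a)]
  split_ifs <;> simp

theorem foxGradient_mul {α : Type*} [DecidableEq α] (u w : FreeGroup α) :
    foxGradient (u * w) =
      foxGradient u + sendToT α (MonoidAlgebra.of ℤ _ u) • foxGradient w := by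
  ext1 a
  simp only [foxGradient, foxDeriv_mul, map_add, map_mul, Pi.add_apply, Pi.smul_apply, smul_eq_mul]

theorem foxGradient_inv {α : Type*} [DecidableEq α] (w : FreeGroup α) :
    foxGradient w⁻¹ = -(sendToT α (MonoidAlgebra.of ℤ _ w⁻¹) • foxGradient w) := by
  have h1 : foxGradient (1 : FreeGroup α) = 0 := by
    ext1 a
    simp [foxGradient, foxDeriv]
  have h := foxGradient_mul w⁻¹ w
  rw [inv_mul_cancel, h1] at h
  exact eq_neg_of_add_eq_zero_left h.symm

/-- The unreduced Burau matrix of a letter: row `i` holds the coefficients of the Fox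
gradient of the outgoing meridian in position `i` with respect to the Fox gradients of the incoming
meridians. It differs from the identity by a matrix of rank one, which is how it is defined. -/
def burau {m : ℕ} (s : Fin m × Bool) : Matrix (Fin (m + 1)) (Fin (m + 1)) ℤ[T;T⁻¹] :=
  1 + Matrix.vecMulVec
    (if s.2 then (T 1 : ℤ[T;T⁻¹]) • Pi.single s.1.castSucc 1 - Pi.single s.1.succ 1
      else Pi.single s.1.castSucc 1 - (T (-1) : ℤ[T;T⁻¹]) • Pi.single s.1.succ 1)
    (Pi.single s.1.succ 1 - Pi.single s.1.castSucc 1)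

theorem burau_mulVec {m : ℕ} (s : Fin m × Bool) (g : Fin (m + 1) → ℤ[T;T⁻¹]) :
    (burau s).mulVec g = g + (g s.1.succ - g s.1.castSucc) •
      (if s.2 then (T 1 : ℤ[T;T⁻¹]) • Pi.single s.1.castSucc 1 - Pi.single s.1.succ 1
        else Pi.single s.1.castSucc 1 - (T (-1) : ℤ[T;T⁻¹]) • Pi.single s.1.succ 1) := by
  rw [burau, Matrix.add_mulVec, Matrix.one_mulVec, Matrix.vecMulVec_mulVec, sub_dotProduct,
    single_dotProduct, single_dotProduct, one_mul, one_mul, op_smul_eq_smul]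

theorem burau_mulVec_one {m : ℕ} (s : Fin m × Bool) : (burau s).mulVec 1 = 1 := by
  simp [burau_mulVec]

/-- The powers of `t` form a left fixed vector of all Burau matrices. -/
theorem vecMul_burau {m : ℕ} (s : Fin m × Bool) :
    Matrix.vecMul (fun i : Fin (m + 1) => T ((i : ℕ) : ℤ)) (burau s) =
      fun i : Fin (m + 1) => T ((i : ℕ) : ℤ) := by
  have h : (fun i : Fin (m + 1) => (T ((i : ℕ) : ℤ) : ℤ[T;T⁻¹])) ⬝ᵥ
      (if s.2 then (T 1 : ℤ[T;T⁻¹]) • Pi.single s.1.castSucc 1 - Pi.single s.1.succ 1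
        else Pi.single s.1.castSucc 1 - (T (-1) : ℤ[T;T⁻¹]) • Pi.single s.1.succ 1) = 0 := by
    split_ifs <;>
    · rw [dotProduct_sub, dotProduct_smul, dotProduct_single_one, dotProduct_single_one,
        smul_eq_mul, ← T_add, Fin.val_castSucc, Fin.val_succ, sub_eq_zero]
      congr 1
      push_cast
      ring
  rw [burau, Matrix.vecMul_add, Matrix.vecMul_one, Matrix.vecMul_vecMulVec, h, zero_smul, add_zero]

theorem sendToT_wirtingerStep_inv {α : Type*} {m : ℕ} (s : Fin m × Bool) (y : Fin (m + 1) → α)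
    (i : Fin (m + 1)) :
    sendToT α (MonoidAlgebra.of ℤ _ (wirtingerStep s (fun j => FreeGroup.of (y j)) i)⁻¹) =
      T (-1) := by
  rw [wirtingerStep]
  split_ifs <;>
    simp only [mul_inv_rev, inv_inv, map_mul, sendToT_of_inv_of, sendToT_of_of, ← T_add] <;> norm_num

theorem foxGradient_conj {α : Type*} [DecidableEq α] (a b : α) :
    foxGradient (FreeGroup.of a * FreeGroup.of b * (FreeGroup.of a)⁻¹) =
      Pi.single a (1 : ℤ[T;T⁻¹]) + (T 1 : ℤ[T;T⁻¹]) • (Pi.single b 1 - Pi.single a 1) := by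
  rw [foxGradient_mul, foxGradient_mul, foxGradient_inv, map_mul, map_mul, sendToT_of_of,
    sendToT_of_of, sendToT_of_inv_of, foxGradient_of, foxGradient_of, smul_neg, smul_smul, ← T_add,
    ← T_add]
  norm_num
  module

theorem foxGradient_inv_conj {α : Type*} [DecidableEq α] (a b : α) :
    foxGradient ((FreeGroup.of b)⁻¹ * FreeGroup.of a * FreeGroup.of b) =
      Pi.single b (1 : ℤ[T;T⁻¹]) - (T (-1) : ℤ[T;T⁻¹]) • (Pi.single b 1 - Pi.single a 1) := by
  rw [foxGradient_mul, foxGradient_mul, foxGradient_inv, map_mul, map_mul, sendToT_of_of,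
    sendToT_of_inv_of, foxGradient_of, foxGradient_of, ← T_add]
  norm_num
  module

theorem foxGradient_wirtingerStep {α : Type*} [DecidableEq α] {m : ℕ} (s : Fin m × Bool)
    (y : Fin (m + 1) → α) (i : Fin (m + 1)) :
    foxGradient (wirtingerStep s (fun j => FreeGroup.of (y j)) i) =
      ∑ j, burau s i j • Pi.single (y j) (1 : ℤ[T;T⁻¹]) := by
  obtain ⟨k, b⟩ := s
  have hk : k.succ ≠ k.castSucc := (Fin.castSucc_lt_succ (i := k)).ne'
  rw [burau]
  simp only [Matrix.add_apply, add_smul, Finset.sum_add_distrib, Matrix.vecMulVec_apply, mul_smul,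
    ← Finset.smul_sum, Matrix.one_apply, Pi.sub_apply, sub_smul, Finset.sum_sub_distrib,
    Pi.single_apply, ite_smul, one_smul, zero_smul, Finset.sum_ite_eq, Finset.mem_univ, if_true,
    Finset.sum_ite_eq', wirtingerStep]
  rcases eq_or_ne i k.castSucc with rfl | h1
  · cases b
    · simp [foxGradient_of, hk.symm]
    · simp [foxGradient_conj, hk.symm]
  · rcases eq_or_ne i k.succ with rfl | h2
    · cases b
      · simp [foxGradient_inv_conj, hk, sub_eq_add_neg, add_comm]
      · simp [foxGradient_of, hk]
    · cases b <;> simp [h1, h2, foxGradient_of]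

/-! ### The Alexander matrix of a closed braid -/

namespace BraidWord

variable {m : ℕ} (w : BraidWord m)

theorem alexanderMatrix_relator_mulVec_inl (g : w.Edge → ℤ[T;T⁻¹]) (k : Fin w.length)
    (i : Fin (m + 1)) :
    (alexanderMatrix w.relator).mulVec g (Sum.inl (k, i)) =
      g (k.succ, i) - (burau (w.get k)).mulVec (fun j => g (k.castSucc, j)) i := by
  change foxGradient (w.relator (Sum.inl (k, i))) ⬝ᵥ g = _
  rw [relator, foxGradient_mul, foxGradient_inv, sendToT_wirtingerStep_inv, sendToT_of_of,
    smul_neg, smul_smul, ← T_add, foxGradient_wirtingerStep, foxGradient_of]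
  simp only [add_neg_cancel, T_zero, one_smul, ← sub_eq_add_neg, sub_dotProduct, sum_dotProduct,
    smul_dotProduct, single_dotProduct, one_mul, smul_eq_mul]
  rfl

theorem alexanderMatrix_relator_mulVec_inr (g : w.Edge → ℤ[T;T⁻¹]) (i : Fin (m + 1)) :
    (alexanderMatrix w.relator).mulVec g (Sum.inr i) = g (Fin.last w.length, i) - g (0, i) := by
  change foxGradient (w.relator (Sum.inr i)) ⬝ᵥ g = _
  rw [relator, foxGradient_mul, foxGradient_inv, sendToT_of_of, sendToT_of_inv_of, smul_neg,
    smul_smul, ← T_add, foxGradient_of, foxGradient_of]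
  simp [← sub_eq_add_neg, sub_dotProduct]

theorem alexanderMatrix_relator_mulVec_one : (alexanderMatrix w.relator).mulVec 1 = 0 := by
  ext1 r
  rcases r with ⟨k, i⟩ | i
  · rw [alexanderMatrix_relator_mulVec_inl]
    have := congrFun (burau_mulVec_one (w.get k)) i
    exact sub_eq_zero.2 this.symm
  · simp [alexanderMatrix_relator_mulVec_inr]

/-- The relation among the Wirtinger relators: the relator of position `i` at a crossing has the
weight `t ^ i`, and that of a closing strand the opposite weight. -/
theorem vecMul_alexanderMatrix_relator :
    Matrix.vecMul (Sum.elim (fun p : Fin w.length × Fin (m + 1) => T ((p.2 : ℕ) : ℤ))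
        (fun i : Fin (m + 1) => -T ((i : ℕ) : ℤ)))
      (alexanderMatrix w.relator) = 0 := by
  ext1 e
  set g : w.Edge → ℤ[T;T⁻¹] := Pi.single e 1 with hg
  -- The sum of `t ^ i * g (k, i)` over the positions at level `k`.
  let f : Fin (w.length + 1) → ℤ[T;T⁻¹] := fun k =>
    (fun i : Fin (m + 1) => T ((i : ℕ) : ℤ)) ⬝ᵥ fun i => g (k, i)
  have hin : ∀ k : Fin w.length, ∑ i : Fin (m + 1), T ((i : ℕ) : ℤ) *
      (alexanderMatrix w.relator).mulVec g (Sum.inl (k, i)) = f k.succ - f k.castSucc := by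
    intro k
    simp only [alexanderMatrix_relator_mulVec_inl, mul_sub, Finset.sum_sub_distrib]
    congr 1
    change _ ⬝ᵥ _ = _
    rw [Matrix.dotProduct_mulVec, vecMul_burau]
  have hout : ∑ i : Fin (m + 1), -T ((i : ℕ) : ℤ) *
      (alexanderMatrix w.relator).mulVec g (Sum.inr i) = f 0 - f (Fin.last _) := by
    simp only [alexanderMatrix_relator_mulVec_inr, neg_mul, mul_sub, Finset.sum_sub_distrib,
      Finset.sum_neg_distrib]
    rw [neg_sub_neg]
    rfl
  have htel := (Fin.sum_univ_succ f).symm.trans (Fin.sum_univ_castSucc f)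
  rw [← dotProduct_single_one (Matrix.vecMul _ _), ← hg, ← Matrix.dotProduct_mulVec, dotProduct,
    Fintype.sum_sum_type, Fintype.sum_prod_type]
  simp only [Sum.elim_inl, Sum.elim_inr]
  rw [hout, Finset.sum_congr rfl fun k _ => hin k, Finset.sum_sub_distrib, Pi.zero_apply]
  linear_combination htel

/-- The Burau matrix of a braid word. The product is in reverse order, because each letter acts
on the meridians below the letters before it. -/
def burauMatrix : Matrix (Fin (m + 1)) (Fin (m + 1)) ℤ[T;T⁻¹] :=
  (w.map burau).reverse.prod

theorem burauMatrix_append (w' : BraidWord m) :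
    burauMatrix (w ++ w') = burauMatrix w' * burauMatrix w := by
  simp [burauMatrix]

theorem burauMatrix_take_succ (k : Fin w.length) :
    burauMatrix (w.take (k + 1)) = burau (w.get k) * burauMatrix (w.take k) := by
  rw [List.take_add_one, List.getElem?_eq_getElem k.2, burauMatrix_append]
  simp [burauMatrix]

theorem alexanderMatrix_relator_mul_burauMatrix_take_inl (k : Fin w.length) (i j : Fin (m + 1)) :
    (alexanderMatrix w.relator).mulVec (fun e => burauMatrix (w.take e.1) e.2 j)
      (Sum.inl (k, i)) = 0 := by
  rw [alexanderMatrix_relator_mulVec_inl, sub_eq_zero]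
  exact congrFun₂ (burauMatrix_take_succ w k) i j

theorem alexanderMatrix_relator_mul_burauMatrix_take_inr (i j : Fin (m + 1)) :
    (alexanderMatrix w.relator).mulVec (fun e => burauMatrix (w.take e.1) e.2 j)
      (Sum.inr i) = (burauMatrix w - 1) i j := by
  rw [alexanderMatrix_relator_mulVec_inr, Matrix.sub_apply]
  simp [burauMatrix]

/-- The bijection of relators and generators that pairs the relator of an edge leaving a crossing
with that edge, and the relators of the closing strands with the edges at level `0`. -/
def relatorEquivEdge : (Fin w.length × Fin (m + 1)) ⊕ Fin (m + 1) ≃ w.Edge where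
  toFun := Sum.elim (fun p => (p.1.succ, p.2)) (fun i => (0, i))
  invFun e := Fin.cases (Sum.inr e.2) (fun k => Sum.inl (k, e.2)) e.1
  left_inv := by rintro (⟨k, i⟩ | i) <;> rfl
  right_inv := by
    rintro ⟨k, i⟩
    refine Fin.cases ?_ (fun k => ?_) k <;> rfl

/-- Solving the Wirtinger relations level by level is a unitriangular process. -/
theorem det_alexanderMatrix_relator_submatrix_inl :
    ((alexanderMatrix w.relator).submatrix Sum.inl
      (fun p : Fin w.length × Fin (m + 1) => (p.1.succ, p.2))).det = 1 := by
  have hval : ∀ k i l j, alexanderMatrix w.relator (Sum.inl (k, i)) (Fin.succ l, j) =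
      (Pi.single (Fin.succ l, j) 1 : w.Edge → ℤ[T;T⁻¹]) (k.succ, i) - (burau (w.get k)).mulVec
        (fun j' => (Pi.single (Fin.succ l, j) 1 : w.Edge → ℤ[T;T⁻¹]) (k.castSucc, j')) i := by
    intro k i l j
    rw [← alexanderMatrix_relator_mulVec_inl, Matrix.mulVec_single_one]
    rfl
  have hzero : ∀ k l : Fin w.length, k ≤ l → ∀ i j, (burau (w.get k)).mulVec
      (fun j' => (Pi.single (Fin.succ l, j) 1 : w.Edge → ℤ[T;T⁻¹]) (k.castSucc, j')) i = 0 := by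
    intro k l hkl i j
    have : (fun j' => (Pi.single (Fin.succ l, j) 1 : w.Edge → ℤ[T;T⁻¹]) (k.castSucc, j')) = 0 := by
      ext1 j'
      refine Pi.single_eq_of_ne (fun h => ?_) _
      have := congrArg (fun e => (e.1 : ℕ)) h
      simp only [Fin.val_castSucc, Fin.val_succ] at this
      have : (k : ℕ) ≤ l := hkl
      omega
    rw [this, Matrix.mulVec_zero, Pi.zero_apply]
  have htri : ((alexanderMatrix w.relator).submatrix Sum.inl
      (fun p : Fin w.length × Fin (m + 1) => (p.1.succ, p.2))).BlockTriangular
        (fun p => OrderDual.toDual p.1) := by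
    rintro ⟨k, i⟩ ⟨l, j⟩ hlt
    replace hlt : k < l := hlt
    rw [Matrix.submatrix_apply, hval, hzero k l hlt.le, sub_zero]
    refine Pi.single_eq_of_ne (fun h => hlt.ne ?_) _
    simpa using congrArg Prod.fst h
  rw [htri.det_fintype]
  refine Finset.prod_eq_one fun k _ => ?_
  rw [← Matrix.det_one (n := {p : Fin w.length × Fin (m + 1) // OrderDual.toDual p.1 = k})]
  congr 1
  ext ⟨⟨a, i⟩, ha⟩ ⟨⟨b, j⟩, hb⟩
  obtain rfl : a = b := OrderDual.toDual.injective (ha.trans hb.symm)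
  rw [Matrix.toSquareBlock_def, Matrix.of_apply, Matrix.submatrix_apply, hval, hzero a a le_rfl,
    sub_zero, Matrix.one_apply, Pi.single_apply]
  simp

/-- Eliminating all meridians except those at level `0` turns a minor of the Alexander matrix into
a minor of the Burau matrix minus the identity. -/
theorem det_alexanderMatrix_updateRow (r s : Fin (m + 1)) :
    (((alexanderMatrix w.relator).submatrix id w.relatorEquivEdge).updateRow (Sum.inr r)
      (Pi.single (Sum.inr s) 1)).det =
      ((burauMatrix w - 1).updateRow r (Pi.single s 1)).det := by
  set N := (alexanderMatrix w.relator).submatrix id w.relatorEquivEdge with hN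
  set N' := N.updateRow (Sum.inr r) (Pi.single (Sum.inr s) 1) with hN'
  let Q : Matrix (Fin w.length × Fin (m + 1)) (Fin (m + 1)) ℤ[T;T⁻¹] :=
    Matrix.of fun p j => burauMatrix (w.take (p.1 + 1)) p.2 j
  let W : Matrix ((Fin w.length × Fin (m + 1)) ⊕ Fin (m + 1))
      ((Fin w.length × Fin (m + 1)) ⊕ Fin (m + 1)) ℤ[T;T⁻¹] := Matrix.fromBlocks 1 Q 0 1
  -- The right block column of `W` lists the meridians at all levels in terms of those at level `0`.
  have hcol : ∀ j, (fun x => W x (Sum.inr j)) =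
      (fun e : w.Edge => burauMatrix (w.take e.1) e.2 j) ∘ w.relatorEquivEdge := by
    intro j
    ext1 x
    rcases x with ⟨k, i⟩ | i
    · rfl
    · simp [W, relatorEquivEdge, burauMatrix]
  have hmul : ∀ x j, (N * W) x (Sum.inr j) = (alexanderMatrix w.relator).mulVec
      (fun e => burauMatrix (w.take e.1) e.2 j) x := by
    intro x j
    rw [Matrix.mul_apply]
    change N x ⬝ᵥ (fun y => W y (Sum.inr j)) = _
    rw [hcol]
    exact Equiv.sum_comp w.relatorEquivEdge
      (fun e => alexanderMatrix w.relator x e * burauMatrix (w.take e.1) e.2 j)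
  have hprod : N' * W = Matrix.fromBlocks N'.toBlocks₁₁ 0 N'.toBlocks₂₁
      ((burauMatrix w - 1).updateRow r (Pi.single s 1)) := by
    refine Matrix.ext fun x y => ?_
    rcases y with y | j
    · have hWy : (fun z => W z (Sum.inl y)) = Pi.single (Sum.inl y) 1 := by
        ext1 z
        rcases z with z | z <;> simp [W, Matrix.one_apply, Pi.single_apply]
      rw [Matrix.mul_apply]
      change N' x ⬝ᵥ (fun z => W z (Sum.inl y)) = _
      rw [hWy, dotProduct_single_one]
      rcases x with x | x <;> rfl
    · rcases x with ⟨k, i⟩ | i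
      · have : (N' * W) (Sum.inl (k, i)) (Sum.inr j) = (N * W) (Sum.inl (k, i)) (Sum.inr j) := by
          simp [Matrix.mul_apply, hN', Matrix.updateRow_ne]
        rw [this, hmul, alexanderMatrix_relator_mul_burauMatrix_take_inl]
        rfl
      · rcases eq_or_ne i r with rfl | hi
        · rw [Matrix.mul_apply]
          change N' (Sum.inr i) ⬝ᵥ (fun z => W z (Sum.inr j)) = _
          rw [hN', Matrix.updateRow_self, single_one_dotProduct]
          simp [W, Matrix.one_apply, Pi.single_apply, eq_comm]
        · have : (N' * W) (Sum.inr i) (Sum.inr j) = (N * W) (Sum.inr i) (Sum.inr j) := by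
            simp [Matrix.mul_apply, hN', Matrix.updateRow_ne, hi]
          rw [this, hmul, alexanderMatrix_relator_mul_burauMatrix_take_inr]
          simp [Matrix.updateRow_ne hi]
  have h11 : N'.toBlocks₁₁.det = 1 := by
    rw [← w.det_alexanderMatrix_relator_submatrix_inl]
    rfl
  have hW : W.det = 1 := by simp [W]
  have hdet := congrArg Matrix.det hprod
  rwa [Matrix.det_mul, hW, mul_one, Matrix.det_fromBlocks_zero₁₂, h11, one_mul] at hdet

/-- The Alexander polynomial of a closed braid from the Burau matrix of the braid. -/
theorem isAlexanderPolynomial_iff_associated (r s : Fin (m + 1)) (Δ : ℤ[T;T⁻¹]) :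
    w.IsAlexanderPolynomial Δ ↔
      Associated Δ ((burauMatrix w - 1).updateRow r (Pi.single s 1)).det := by
  have hE := elementaryIdeal_one_eq_span (alexanderMatrix w.relator) w.relatorEquivEdge
    w.alexanderMatrix_relator_mulVec_one w.vecMul_alexanderMatrix_relator
    (by
      rintro (p | i)
      · exact isUnit_T _
      · exact (isUnit_T _).neg) (Sum.inr r) (Sum.inr s)
  rw [det_alexanderMatrix_updateRow] at hE
  rw [IsAlexanderPolynomial, hE, ← Ideal.span_singleton_eq_span_singleton]
  constructor
  · intro h
    exact le_antisymm (h.2 ⟨⟨_, rfl⟩, le_rfl⟩) h.1.2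
  · intro h
    rw [h]
    exact ⟨⟨⟨_, rfl⟩, le_rfl⟩, fun I hI => hI.2⟩

end BraidWord

/-! ### Expansion of determinants of order four and five -/

section
variable {R : Type*} [CommRing R]

theorem det_fin_four_row_zero (M : Matrix (Fin 4) (Fin 4) R) :
    M.det = M 0 0 * (M.submatrix ![1, 2, 3] ![1, 2, 3]).det
      - M 0 1 * (M.submatrix ![1, 2, 3] ![0, 2, 3]).det
      + M 0 2 * (M.submatrix ![1, 2, 3] ![0, 1, 3]).det
      - M 0 3 * (M.submatrix ![1, 2, 3] ![0, 1, 2]).det := by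
  have h : (Fin.succ : Fin 3 → Fin 4) = ![1, 2, 3] := by decide
  have h0 : Fin.succAbove (0 : Fin 4) = ![1, 2, 3] := by decide
  have h1 : Fin.succAbove (1 : Fin 4) = ![0, 2, 3] := by decide
  have h2 : Fin.succAbove (2 : Fin 4) = ![0, 1, 3] := by decide
  have h3 : Fin.succAbove (3 : Fin 4) = ![0, 1, 2] := by decide
  rw [Matrix.det_succ_row_zero, Fin.sum_univ_four, h, h0, h1, h2, h3]
  simp only [Fin.coe_ofNat_eq_mod]
  ring

theorem det_fin_five_row_zero (M : Matrix (Fin 5) (Fin 5) R) :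
    M.det = M 0 0 * (M.submatrix ![1, 2, 3, 4] ![1, 2, 3, 4]).det
      - M 0 1 * (M.submatrix ![1, 2, 3, 4] ![0, 2, 3, 4]).det
      + M 0 2 * (M.submatrix ![1, 2, 3, 4] ![0, 1, 3, 4]).det
      - M 0 3 * (M.submatrix ![1, 2, 3, 4] ![0, 1, 2, 4]).det
      + M 0 4 * (M.submatrix ![1, 2, 3, 4] ![0, 1, 2, 3]).det := by
  have h : (Fin.succ : Fin 4 → Fin 5) = ![1, 2, 3, 4] := by decide
  have h0 : Fin.succAbove (0 : Fin 5) = ![1, 2, 3, 4] := by decide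
  have h1 : Fin.succAbove (1 : Fin 5) = ![0, 2, 3, 4] := by decide
  have h2 : Fin.succAbove (2 : Fin 5) = ![0, 1, 3, 4] := by decide
  have h3 : Fin.succAbove (3 : Fin 5) = ![0, 1, 2, 4] := by decide
  have h4 : Fin.succAbove (4 : Fin 5) = ![0, 1, 2, 3] := by decide
  rw [Matrix.det_succ_row_zero, Fin.sum_univ_five, h, h0, h1, h2, h3, h4]
  simp only [Fin.coe_ofNat_eq_mod]
  ring

/-! ### The powers of the block and the determinant in two variables -/

/-- The Burau matrix of `σ₃σ₂σ₄σ₁σ₃σ₅σ₂σ₄σ₃`, over any commutative ring with an element `t`. -/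
def blockMatrix (t : R) : Matrix (Fin 6) (Fin 6) R :=
  !![1 - t, t - t ^ 2, t ^ 2 - t ^ 3, t ^ 3, 0, 0;
    1 - t, t - t ^ 2, t ^ 2 - t ^ 3, 0, t ^ 3, 0;
    1 - t, t - t ^ 2, t ^ 2 - t ^ 3, 0, 0, t ^ 3;
    1, 0, 0, 0, 0, 0;
    0, 1, 0, 0, 0, 0;
    0, 0, 1, 0, 0, 0]

/-- The Burau matrix of `σ₃σ₂σ₁σ₁σ₂σ₃σ₂σ₁σ₂σ₂`, over any commutative ring with an element `t`. -/
def tailMatrix (t : R) : Matrix (Fin 6) (Fin 6) R :=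
  !![1 - t, t - t ^ 2, t ^ 2 - t ^ 3 + t ^ 4, t ^ 3 - t ^ 4, 0, 0;
    1 - t + t ^ 3, t - t ^ 2, t ^ 2 - 2 * t ^ 3 + t ^ 4, t ^ 3 - t ^ 4, 0, 0;
    1 - t, t - t ^ 2 + t ^ 3, t ^ 2 - 2 * t ^ 3 + t ^ 4, t ^ 3 - t ^ 4, 0, 0;
    1 - t, t - t ^ 2, t ^ 2 - t ^ 3, t ^ 3, 0, 0;
    0, 0, 0, 0, 1, 0;
    0, 0, 0, 0, 0, 1]

/-- The columns are, for each half of the six coordinates, the first basis vector scaled by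
`q = 1 + t + ⋯ + t⁵` and two vectors that `(1, t, t²)` annihilates. The scaling clears the
denominators of the powers of `blockMatrix t` in this basis. -/
def basisMatrix (t : R) : Matrix (Fin 6) (Fin 6) R :=
  !![1 + t + t ^ 2 + t ^ 3 + t ^ 4 + t ^ 5, -t, 0, 0, 0, 0;
    0, 1, -t, 0, 0, 0;
    0, 0, 1, 0, 0, 0;
    0, 0, 0, 1 + t + t ^ 2 + t ^ 3 + t ^ 4 + t ^ 5, -t, 0;
    0, 0, 0, 0, 1, -t;
    0, 0, 0, 0, 0, 1]

/-- The odd powers of `blockMatrix t`, applied to the columns of `basisMatrix t`: the power with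
exponent `2 * n + 1` is the value at `u = t ^ (3 * n)`. -/
def powerMatrix (t u : R) : Matrix (Fin 6) (Fin 6) R :=
  let q := 1 + t + t ^ 2 + t ^ 3 + t ^ 4 + t ^ 5
  let a := 1 - t ^ 6 * u ^ 2
  let b := 1 + t ^ 3 * u ^ 2 - (1 + t ^ 3) * u
  let c := t ^ 3 + t ^ 6 * u ^ 2 - (1 + t ^ 3) * t ^ 3 * u
  let d := t ^ 3 - t ^ 3 * u ^ 2
  !![a, 0, 0, c + q * t ^ 3 * u, -t ^ 4 * u, 0;
    a, 0, 0, c, t ^ 3 * u, -t ^ 4 * u;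
    a, 0, 0, c, 0, t ^ 3 * u;
    b + q * u, -t * u, 0, d, 0, 0;
    b, u, -t * u, d, 0, 0;
    b, 0, u, d, 0, 0]

theorem blockMatrix_mul_basisMatrix (t : R) :
    blockMatrix t * basisMatrix t = powerMatrix t 1 := by
  ext i j
  fin_cases i <;> fin_cases j <;>
    simp [blockMatrix, basisMatrix, powerMatrix, Matrix.mul_apply, Fin.sum_univ_six] <;> ring

theorem blockMatrix_mul_of (t : R) (a b c d e f : Fin 6 → R) :
    blockMatrix t * Matrix.of ![a, b, c, d, e, f] =
      Matrix.of ![(1 - t) • (a + t • b + t ^ 2 • c) + t ^ 3 • d,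
        (1 - t) • (a + t • b + t ^ 2 • c) + t ^ 3 • e,
        (1 - t) • (a + t • b + t ^ 2 • c) + t ^ 3 • f, a, b, c] := by
  ext i j
  fin_cases i <;> simp [blockMatrix, Matrix.mul_apply, Fin.sum_univ_six] <;> ring

/-- The recursion for the odd powers of `blockMatrix t`: two more factors multiply `u` by `t³`. -/
theorem blockMatrix_mul_mul_powerMatrix (t u : R) :
    blockMatrix t * (blockMatrix t * powerMatrix t u) = powerMatrix t (t ^ 3 * u) := by
  simp only [powerMatrix, blockMatrix_mul_of]
  refine congrArg Matrix.of ?_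
  simp only [Matrix.smul_cons, Matrix.cons_add_cons, smul_eq_mul, Matrix.smul_empty,
    Matrix.empty_add_empty, Matrix.vecCons_inj, and_true]
  refine ⟨⟨?_, ?_, ?_, ?_, ?_, ?_⟩, ⟨?_, ?_, ?_, ?_, ?_, ?_⟩, ⟨?_, ?_, ?_, ?_, ?_, ?_⟩,
    ⟨?_, ?_, ?_, ?_, ?_, ?_⟩, ⟨?_, ?_, ?_, ?_, ?_, ?_⟩, ⟨?_, ?_, ?_, ?_, ?_, ?_⟩⟩ <;> ring

theorem det_basisMatrix (t : R) :
    (basisMatrix t).det = (1 + t + t ^ 2 + t ^ 3 + t ^ 4 + t ^ 5) ^ 2 := by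
  simp [basisMatrix, Matrix.det_succ_row_zero, Fin.sum_univ_succ]
  ring

/-- Equality of matrices can be checked on their actions as row operations. -/
theorem eq_of_forall_mul_of_eq {A B : Matrix (Fin 6) (Fin 6) R}
    (h : ∀ a b c d e f : Fin 6 → R, A * Matrix.of ![a, b, c, d, e, f] =
      B * Matrix.of ![a, b, c, d, e, f]) : A = B := by
  have h1 : (1 : Matrix (Fin 6) (Fin 6) R) = Matrix.of ![Pi.single 0 1, Pi.single 1 1,
      Pi.single 2 1, Pi.single 3 1, Pi.single 4 1, Pi.single 5 1] := by
    refine Matrix.ext fun i j => ?_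
    fin_cases i <;> simp [Matrix.one_apply, Pi.single_apply, eq_comm]
  rw [← mul_one A, ← mul_one B, h1, h]

theorem tailMatrix_mul_of (t : R) (a b c d e f : Fin 6 → R) :
    tailMatrix t * Matrix.of ![a, b, c, d, e, f] =
      Matrix.of ![(1 - t) • (a + t • b + t ^ 2 • c) + t ^ 4 • c + (t ^ 3 - t ^ 4) • d,
        (1 - t) • (a + t • b + t ^ 2 • c) + t ^ 3 • a + (t ^ 4 - t ^ 3) • c + (t ^ 3 - t ^ 4) • d,
        (1 - t) • (a + t • b + t ^ 2 • c) + t ^ 3 • b + (t ^ 4 - t ^ 3) • c + (t ^ 3 - t ^ 4) • d,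
        (1 - t) • (a + t • b + t ^ 2 • c) + t ^ 3 • d, e, f] := by
  ext i j
  fin_cases i <;> simp [tailMatrix, Matrix.mul_apply, Fin.sum_univ_six] <;> ring

/-- At `u = t ^ (3 * n)` the left-hand side is the Burau matrix of the braid minus the identity,
applied to the columns of `basisMatrix t`. The entries `a, b, c, d` are those of
`powerMatrix t u`. -/
theorem tailMatrix_mul_powerMatrix_sub_basisMatrix {t u q a b c d p x : R}
    (hq : q = 1 + t + t ^ 2 + t ^ 3 + t ^ 4 + t ^ 5)
    (ha : a = 1 - t ^ 6 * u ^ 2) (hb : b = 1 + t ^ 3 * u ^ 2 - (1 + t ^ 3) * u)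
    (hc : c = t ^ 3 + t ^ 6 * u ^ 2 - (1 + t ^ 3) * t ^ 3 * u) (hd : d = t ^ 3 - t ^ 3 * u ^ 2)
    (hp : p = a + t ^ 3 * (1 - t) * (b + q * u - a))
    (hx : x = c + t ^ 3 * (1 - t) * (d + q * u - c)) :
    tailMatrix t * powerMatrix t u - basisMatrix t =
      !![p - q, t - (1 - t) * t ^ 4 * u, 0, x, 0, t ^ 7 * u;
        p, -1 - (1 - t) * t ^ 4 * u, t, x + q * t ^ 6 * u, -t ^ 7 * u, -(1 - t) * t ^ 6 * u;
        p, -(1 - t) * t ^ 4 * u, -1, x, t ^ 6 * u, -t ^ 6 * u;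
        a + t ^ 3 * (b + q * u - a), -t ^ 4 * u, 0,
          c + t ^ 3 * (d - c) + q * (t ^ 3 * u - t ^ 4 * u - 1), t, 0;
        b, u, -t * u, d, -1, t;
        b, 0, u, d, 0, -1] := by
  simp only [powerMatrix, basisMatrix, tailMatrix_mul_of, Matrix.of_sub_of]
  refine congrArg Matrix.of ?_
  simp only [Matrix.smul_cons, Matrix.cons_add_cons, smul_eq_mul, Matrix.smul_empty,
    Matrix.empty_add_empty, Matrix.cons_sub_cons, Matrix.empty_sub_empty, Matrix.vecCons_inj,
    and_true, hp, hx, ha, hb, hc, hd, hq]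
  refine ⟨⟨?_, ?_, ?_, ?_, ?_, ?_⟩, ⟨?_, ?_, ?_, ?_, ?_, ?_⟩, ⟨?_, ?_, ?_, ?_, ?_, ?_⟩,
    ⟨?_, ?_, ?_, ?_, ?_, ?_⟩, ⟨?_, ?_, ?_, ?_, ?_, ?_⟩, ⟨?_, ?_, ?_, ?_, ?_, ?_⟩⟩ <;> ring

/-- At `u = t ^ (3 * n)` the left-hand side is the minor of the Burau matrix minus the identity,
times the determinant `q ^ 2` of `basisMatrix t`: the row that replaces row `0` is the same in both
bases, because the last row of `basisMatrix t` is a basis vector. -/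
theorem det_updateRow_tailMatrix_mul_powerMatrix_sub_basisMatrix (t u : R) :
    ((tailMatrix t * powerMatrix t u - basisMatrix t).updateRow 0 (Pi.single 5 1)).det =
      -(1 + t + t ^ 2 + t ^ 3 + t ^ 4 + t ^ 5) *
        (t ^ 19 * u ^ 6 + t ^ 15 * u ^ 4 + t ^ 11 * u ^ 4 + t ^ 8 * u ^ 2 + t ^ 4 * u ^ 2 + 1) := by
  -- The seven polynomials stay opaque while the determinant is expanded.
  obtain ⟨q, hq⟩ : ∃ q : R, q = 1 + t + t ^ 2 + t ^ 3 + t ^ 4 + t ^ 5 := ⟨_, rfl⟩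
  obtain ⟨a, ha⟩ : ∃ a : R, a = 1 - t ^ 6 * u ^ 2 := ⟨_, rfl⟩
  obtain ⟨b, hb⟩ : ∃ b : R, b = 1 + t ^ 3 * u ^ 2 - (1 + t ^ 3) * u := ⟨_, rfl⟩
  obtain ⟨c, hc⟩ : ∃ c : R, c = t ^ 3 + t ^ 6 * u ^ 2 - (1 + t ^ 3) * t ^ 3 * u := ⟨_, rfl⟩
  obtain ⟨d, hd⟩ : ∃ d : R, d = t ^ 3 - t ^ 3 * u ^ 2 := ⟨_, rfl⟩
  obtain ⟨p, hp⟩ : ∃ p : R, p = a + t ^ 3 * (1 - t) * (b + q * u - a) := ⟨_, rfl⟩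
  obtain ⟨x, hx⟩ : ∃ x : R, x = c + t ^ 3 * (1 - t) * (d + q * u - c) := ⟨_, rfl⟩
  rw [← Matrix.adjugate_apply, Matrix.adjugate_fin_succ_eq_det_submatrix,
    tailMatrix_mul_powerMatrix_sub_basisMatrix hq ha hb hc hd hp hx,
    show Fin.succAbove (0 : Fin 6) = ![1, 2, 3, 4, 5] by decide,
    show Fin.succAbove (5 : Fin 6) = ![0, 1, 2, 3, 4] by decide]
  simp only [det_fin_five_row_zero, det_fin_four_row_zero, Matrix.det_fin_three,
    Matrix.submatrix_apply, Matrix.of_apply, Matrix.cons_val, Fin.coe_ofNat_eq_mod]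
  subst hx hp hd hc hb ha hq
  ring

end

/-! ### The Burau matrix of the braid -/

section

/-- A letter acts on a matrix by a row operation. -/
theorem burau_mul {m n : ℕ} (s : Fin m × Bool) (X : Matrix (Fin (m + 1)) (Fin n) ℤ[T;T⁻¹]) :
    burau s * X = X + Matrix.vecMulVec
      (if s.2 then (T 1 : ℤ[T;T⁻¹]) • Pi.single s.1.castSucc 1 - Pi.single s.1.succ 1
        else Pi.single s.1.castSucc 1 - (T (-1) : ℤ[T;T⁻¹]) • Pi.single s.1.succ 1)
      (X s.1.succ - X s.1.castSucc) := by
  rw [burau, Matrix.add_mul, Matrix.one_mul, Matrix.vecMulVec_mul, Matrix.sub_vecMul,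
    Matrix.single_one_vecMul, Matrix.single_one_vecMul]
  rfl

variable (a b c d e f : Fin 6 → ℤ[T;T⁻¹])

theorem burau_sigma_one_mul_of : burau (sigma 1) * Matrix.of ![a, b, c, d, e, f] =
    Matrix.of ![a + (T 1 : ℤ[T;T⁻¹]) • (b - a), a, c, d, e, f] := by
  rw [burau_mul]
  refine Matrix.ext fun i j => ?_
  fin_cases i <;> simp [sigma, Matrix.vecMulVec_apply]

theorem burau_sigma_two_mul_of : burau (sigma 2) * Matrix.of ![a, b, c, d, e, f] =
    Matrix.of ![a, b + (T 1 : ℤ[T;T⁻¹]) • (c - b), b, d, e, f] := by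
  rw [burau_mul]
  refine Matrix.ext fun i j => ?_
  fin_cases i <;> simp [sigma, Matrix.vecMulVec_apply]

theorem burau_sigma_three_mul_of : burau (sigma 3) * Matrix.of ![a, b, c, d, e, f] =
    Matrix.of ![a, b, c + (T 1 : ℤ[T;T⁻¹]) • (d - c), c, e, f] := by
  rw [burau_mul]
  refine Matrix.ext fun i j => ?_
  fin_cases i <;> simp [sigma, Matrix.vecMulVec_apply]

theorem burau_sigma_four_mul_of : burau (sigma 4) * Matrix.of ![a, b, c, d, e, f] =
    Matrix.of ![a, b, c, d + (T 1 : ℤ[T;T⁻¹]) • (e - d), d, f] := by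
  rw [burau_mul]
  refine Matrix.ext fun i j => ?_
  fin_cases i <;> simp [sigma, Matrix.vecMulVec_apply]

theorem burau_sigma_five_mul_of : burau (sigma 5) * Matrix.of ![a, b, c, d, e, f] =
    Matrix.of ![a, b, c, d, e + (T 1 : ℤ[T;T⁻¹]) • (f - e), e] := by
  rw [burau_mul]
  refine Matrix.ext fun i j => ?_
  fin_cases i <;> simp [sigma, Matrix.vecMulVec_apply]

theorem burauMatrix_nil_mul {m n : ℕ} (X : Matrix (Fin (m + 1)) (Fin n) ℤ[T;T⁻¹]) :
    BraidWord.burauMatrix ([] : BraidWord m) * X = X := by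
  simp [BraidWord.burauMatrix]

theorem burauMatrix_cons_mul {m n : ℕ} (s : Fin m × Bool) (w : BraidWord m)
    (X : Matrix (Fin (m + 1)) (Fin n) ℤ[T;T⁻¹]) :
    BraidWord.burauMatrix (s :: w : List _) * X = BraidWord.burauMatrix w * (burau s * X) := by
  simp [BraidWord.burauMatrix, Matrix.mul_assoc]

theorem burauMatrix_block : BraidWord.burauMatrix
    [sigma 3, sigma 2, sigma 4, sigma 1, sigma 3, sigma 5, sigma 2, sigma 4, sigma 3] =
      blockMatrix (T 1) := by
  refine eq_of_forall_mul_of_eq fun a b c d e f => ?_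
  rw [blockMatrix_mul_of]
  simp only [burauMatrix_cons_mul, burauMatrix_nil_mul]
  rw [burau_sigma_three_mul_of, burau_sigma_two_mul_of, burau_sigma_four_mul_of,
    burau_sigma_one_mul_of, burau_sigma_three_mul_of, burau_sigma_five_mul_of,
    burau_sigma_two_mul_of, burau_sigma_four_mul_of, burau_sigma_three_mul_of]
  refine congrArg Matrix.of ?_
  simp only [Matrix.vecCons_inj, and_true]
  refine ⟨?_, ?_, ?_⟩ <;> module

theorem burauMatrix_tail : BraidWord.burauMatrix
    [sigma 3, sigma 2, sigma 1, sigma 1, sigma 2, sigma 3, sigma 2, sigma 1, sigma 2, sigma 2] =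
      tailMatrix (T 1) := by
  refine eq_of_forall_mul_of_eq fun a b c d e f => ?_
  rw [tailMatrix_mul_of]
  simp only [burauMatrix_cons_mul, burauMatrix_nil_mul]
  rw [burau_sigma_three_mul_of, burau_sigma_two_mul_of, burau_sigma_one_mul_of,
    burau_sigma_one_mul_of, burau_sigma_two_mul_of, burau_sigma_three_mul_of,
    burau_sigma_two_mul_of, burau_sigma_one_mul_of, burau_sigma_two_mul_of,
    burau_sigma_two_mul_of]
  refine congrArg Matrix.of ?_
  simp only [Matrix.vecCons_inj, and_true]
  refine ⟨?_, ?_, ?_, ?_⟩ <;> module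

theorem burauMatrix_betaWord (n : ℕ) :
    (betaWord n).burauMatrix = tailMatrix (T 1) * blockMatrix (T 1) ^ (2 * n + 1) := by
  rw [betaWord, BraidWord.burauMatrix_append, burauMatrix_tail, ← burauMatrix_block]
  congr 1
  induction 2 * n + 1 with
  | zero => simp [BraidWord.burauMatrix]
  | succ k ih =>
    rw [List.replicate_succ, List.flatten_cons, BraidWord.burauMatrix_append, ih, pow_succ]

theorem blockMatrix_pow_mul_basisMatrix {R : Type*} [CommRing R] (t : R) (n : ℕ) :
    blockMatrix t ^ (2 * n + 1) * basisMatrix t = powerMatrix t (t ^ (3 * n)) := by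
  induction n with
  | zero => simp [blockMatrix_mul_basisMatrix]
  | succ k ih =>
    rw [show 2 * (k + 1) + 1 = (2 * k + 1) + 1 + 1 by ring, pow_succ', pow_succ', Matrix.mul_assoc,
      Matrix.mul_assoc, ih, blockMatrix_mul_mul_powerMatrix, ← pow_add]
    congr 2
    ring

theorem sum_T_ne_zero : (1 + T 1 + T 2 + T 3 + T 4 + T 5 : ℤ[T;T⁻¹]) ≠ 0 := by
  intro h
  have := congrArg (LaurentPolynomial.eval₂ (RingHom.id ℤ) 1) h
  simp at this

theorem det_burauMatrix_betaWord (n : ℕ) :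
    (((betaWord n).burauMatrix - 1).updateRow 0 (Pi.single 5 1)).det *
      (1 + T 1 + T 2 + T 3 + T 4 + T 5) =
      -(T (18 * (n : ℤ) + 19) + T (12 * (n : ℤ) + 15) + T (12 * (n : ℤ) + 11)
          + T (6 * (n : ℤ) + 8) + T (6 * (n : ℤ) + 4) + 1) := by
  obtain ⟨t, ht⟩ : ∃ t : ℤ[T;T⁻¹], t = T 1 := ⟨_, rfl⟩
  have hT : ∀ k : ℕ, (T (k : ℤ) : ℤ[T;T⁻¹]) = t ^ k := fun k => by rw [ht, T_pow, mul_one]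
  have hq : (1 + T 1 + T 2 + T 3 + T 4 + T 5 : ℤ[T;T⁻¹]) =
      1 + t + t ^ 2 + t ^ 3 + t ^ 4 + t ^ 5 := by
    rw [← hT 2, ← hT 3, ← hT 4, ← hT 5, ht]
    rfl
  have hrow : Matrix.vecMul (Pi.single 5 1) (basisMatrix t) = Pi.single 5 1 := by
    rw [Matrix.single_one_vecMul]
    ext1 j
    fin_cases j <;> simp [basisMatrix]
  have hdet := det_updateRow_tailMatrix_mul_powerMatrix_sub_basisMatrix t (t ^ (3 * n))
  rw [← blockMatrix_pow_mul_basisMatrix, ← Matrix.mul_assoc, ht, ← burauMatrix_betaWord,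
    ← ht] at hdet
  nth_rewrite 2 [← Matrix.one_mul (basisMatrix t)] at hdet
  rw [← Matrix.sub_mul, ← hrow, ← Matrix.updateRow_mul, Matrix.det_mul, det_basisMatrix,
    ← hq] at hdet
  apply mul_right_cancel₀ sum_T_ne_zero
  rw [mul_assoc, ← pow_two, hdet]
  have e1 : (T (18 * (n : ℤ) + 19) : ℤ[T;T⁻¹]) = t ^ (18 * n + 19) := by rw [← hT]; push_cast; rfl
  have e2 : (T (12 * (n : ℤ) + 15) : ℤ[T;T⁻¹]) = t ^ (12 * n + 15) := by rw [← hT]; push_cast; rfl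
  have e3 : (T (12 * (n : ℤ) + 11) : ℤ[T;T⁻¹]) = t ^ (12 * n + 11) := by rw [← hT]; push_cast; rfl
  have e4 : (T (6 * (n : ℤ) + 8) : ℤ[T;T⁻¹]) = t ^ (6 * n + 8) := by rw [← hT]; push_cast; rfl
  have e5 : (T (6 * (n : ℤ) + 4) : ℤ[T;T⁻¹]) = t ^ (6 * n + 4) := by rw [← hT]; push_cast; rfl
  rw [e1, e2, e3, e4, e5]
  ring

/-! ### The two formulas -/

/-- The sum formula and the closed formula for the Alexander polynomial agree. -/
theorem alexander_sum_formula_mul_sum_T (n : ℕ) :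
    (T (6 * (n : ℤ) + 4) + ∑ i ∈ Finset.range (n + 1),
          ((T (6 * ((n : ℤ) - i)) - T (6 * ((n : ℤ) - i) + 1))
            + (T (6 * ((n : ℤ) + i) + 6) - T (6 * ((n : ℤ) + i) + 5))
            + (T (6 * ((n : ℤ) + i) + 8) - T (6 * ((n : ℤ) + i) + 7))
            + (T (6 * ((n : ℤ) + i) + 10) - T (6 * ((n : ℤ) + i) + 9))
            + (T (6 * (2 * (n : ℤ) + i) + 14) - T (6 * (2 * (n : ℤ) + i) + 13))) : ℤ[T;T⁻¹]) *
      (1 + T 1 + T 2 + T 3 + T 4 + T 5) =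
      T (18 * (n : ℤ) + 19) + T (12 * (n : ℤ) + 15) + T (12 * (n : ℤ) + 11)
          + T (6 * (n : ℤ) + 8) + T (6 * (n : ℤ) + 4) + 1 := by
  obtain ⟨t, ht⟩ : ∃ t : ℤ[T;T⁻¹], t = T 1 := ⟨_, rfl⟩
  have hT : ∀ k : ℕ, (T (k : ℤ) : ℤ[T;T⁻¹]) = t ^ k := fun k => by rw [ht, T_pow, mul_one]
  have hT' : ∀ (z : ℤ) (k : ℕ), z = k → (T z : ℤ[T;T⁻¹]) = t ^ k := by
    rintro _ k rfl
    exact hT k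
  -- The sum over `i` is a multiple of the geometric sum `G`, which `1 - t ^ 6` telescopes.
  set G : ℤ[T;T⁻¹] := ∑ i ∈ Finset.range (n + 1), (t ^ 6) ^ i with hG
  have hgeom : G * (1 - t ^ 6) = 1 - (t ^ 6) ^ (n + 1) := by
    rw [hG]
    linear_combination -geom_sum_mul (t ^ 6) (n + 1)
  have hrefl : ∑ i ∈ Finset.range (n + 1), (T (6 * ((n : ℤ) - i)) : ℤ[T;T⁻¹]) = G := by
    rw [hG, ← Finset.sum_range_reflect]
    refine Finset.sum_congr rfl fun i hi => ?_
    have : i ≤ n := Nat.lt_succ_iff.1 (Finset.mem_range.1 hi)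
    rw [← pow_mul]
    refine hT' _ _ ?_
    push_cast [Nat.cast_sub this]
    omega
  have hsum : ∑ i ∈ Finset.range (n + 1),
      ((T (6 * ((n : ℤ) - i)) - T (6 * ((n : ℤ) - i) + 1))
        + (T (6 * ((n : ℤ) + i) + 6) - T (6 * ((n : ℤ) + i) + 5))
        + (T (6 * ((n : ℤ) + i) + 8) - T (6 * ((n : ℤ) + i) + 7))
        + (T (6 * ((n : ℤ) + i) + 10) - T (6 * ((n : ℤ) + i) + 9))
        + (T (6 * (2 * (n : ℤ) + i) + 14) - T (6 * (2 * (n : ℤ) + i) + 13)) : ℤ[T;T⁻¹]) =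
      (1 - t) * (1 - t ^ (6 * n + 5) - t ^ (6 * n + 7) - t ^ (6 * n + 9) - t ^ (12 * n + 13)) *
        G := by
    have hterm : ∀ i ∈ Finset.range (n + 1),
        ((T (6 * ((n : ℤ) - i)) - T (6 * ((n : ℤ) - i) + 1))
        + (T (6 * ((n : ℤ) + i) + 6) - T (6 * ((n : ℤ) + i) + 5))
        + (T (6 * ((n : ℤ) + i) + 8) - T (6 * ((n : ℤ) + i) + 7))
        + (T (6 * ((n : ℤ) + i) + 10) - T (6 * ((n : ℤ) + i) + 9))
        + (T (6 * (2 * (n : ℤ) + i) + 14) - T (6 * (2 * (n : ℤ) + i) + 13)) : ℤ[T;T⁻¹]) =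
        (1 - t) * T (6 * ((n : ℤ) - i)) - (1 - t) *
          (t ^ (6 * n + 5) + t ^ (6 * n + 7) + t ^ (6 * n + 9) + t ^ (12 * n + 13)) *
            (t ^ 6) ^ i := by
      intro i _
      rw [T_add (6 * ((n : ℤ) - i)) 1, ← ht,
        hT' (6 * ((n : ℤ) + i) + 6) (6 * (n + i) + 6) (by push_cast; ring),
        hT' (6 * ((n : ℤ) + i) + 5) (6 * (n + i) + 5) (by push_cast; ring),
        hT' (6 * ((n : ℤ) + i) + 8) (6 * (n + i) + 8) (by push_cast; ring),
        hT' (6 * ((n : ℤ) + i) + 7) (6 * (n + i) + 7) (by push_cast; ring),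
        hT' (6 * ((n : ℤ) + i) + 10) (6 * (n + i) + 10) (by push_cast; ring),
        hT' (6 * ((n : ℤ) + i) + 9) (6 * (n + i) + 9) (by push_cast; ring),
        hT' (6 * (2 * (n : ℤ) + i) + 14) (6 * (2 * n + i) + 14) (by push_cast; ring),
        hT' (6 * (2 * (n : ℤ) + i) + 13) (6 * (2 * n + i) + 13) (by push_cast; ring)]
      ring
    rw [Finset.sum_congr rfl hterm, Finset.sum_sub_distrib, ← Finset.mul_sum, ← Finset.mul_sum,
      hrefl, ← hG]
    ring
  rw [hsum, hT' 2 2 rfl, hT' 3 3 rfl, hT' 4 4 rfl, hT' 5 5 rfl, ← ht,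
    hT' (18 * (n : ℤ) + 19) (18 * n + 19) (by push_cast; ring),
    hT' (12 * (n : ℤ) + 15) (12 * n + 15) (by push_cast; ring),
    hT' (12 * (n : ℤ) + 11) (12 * n + 11) (by push_cast; ring),
    hT' (6 * (n : ℤ) + 8) (6 * n + 8) (by push_cast; ring),
    hT' (6 * (n : ℤ) + 4) (6 * n + 4) (by push_cast; ring)]
  linear_combination
    (1 - t ^ (6 * n + 5) - t ^ (6 * n + 7) - t ^ (6 * n + 9) - t ^ (12 * n + 13)) * hgeom

end

end

theorem theorem4 (n : ℕ) (hn : 1 ≤ n) :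
    (∀ Δ : ℤ[T;T⁻¹], (betaWord n).IsAlexanderPolynomial Δ ↔
      Associated Δ
        (T (6 * (n : ℤ) + 4) + ∑ i ∈ Finset.range (n + 1),
          ((T (6 * ((n : ℤ) - i)) - T (6 * ((n : ℤ) - i) + 1))
            + (T (6 * ((n : ℤ) + i) + 6) - T (6 * ((n : ℤ) + i) + 5))
            + (T (6 * ((n : ℤ) + i) + 8) - T (6 * ((n : ℤ) + i) + 7))
            + (T (6 * ((n : ℤ) + i) + 10) - T (6 * ((n : ℤ) + i) + 9))
            + (T (6 * (2 * (n : ℤ) + i) + 14) - T (6 * (2 * (n : ℤ) + i) + 13))))) ∧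
    (∀ Δ : ℤ[T;T⁻¹], (betaWord n).IsAlexanderPolynomial Δ ↔
      Associated (Δ * (1 + T 1 + T 2 + T 3 + T 4 + T 5))
        (T (18 * (n : ℤ) + 19) + T (12 * (n : ℤ) + 15) + T (12 * (n : ℤ) + 11)
          + T (6 * (n : ℤ) + 8) + T (6 * (n : ℤ) + 4) + 1)) := by
  have hq := sum_T_ne_zero
  have hF := alexander_sum_formula_mul_sum_T n
  have hdet := det_burauMatrix_betaWord n
  rw [← hF, ← neg_mul] at hdet
  have hfirst := fun Δ => (betaWord n).isAlexanderPolynomial_iff_associated 0 5 Δ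
  simp only [mul_right_cancel₀ hq hdet, Associated.neg_right_iff] at hfirst
  refine ⟨hfirst, fun Δ => ?_⟩
  rw [hfirst, ← hF]
  exact ⟨fun h => h.mul_right _, fun h => h.of_mul_right (Associated.refl _) hq⟩
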